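/- Let $(G,+)$ be a compact, Hausdorff, second-countable Abelian topological group with Haar measure $\lambda_G$. Let $\mathrm M$ be the space of positive Borel measures $\xi$ on $G$ with $\xi(K)<\infty$ for every compact $K$, with the $\sigma$-algebra generated by the maps $\xi\mapsto\xi(K)$, $K$ compact, and let $G$ act on $\mathrm M$ by $\tau_t\xi=\xi(\cdot+t)$. A measure on $\mathrm M$ is stationary if it is invariant under all $\tau_t$. The Palm measure of a $\sigma$-finite stationary measure $\mathrm P$ on $\mathrm M$ is $$\mathrm P_0(A)=\int_{\mathrm M}\int_G \omega(t)\,\mathbf 1(\tau_t\xi\in A)\,\xi(\mathrm dt)\,\mathrm P(\mathrm d\xi),$$ where $\omega:G\to\mathbb R_+$ is any measurable function with $\int_G\omega\,\mathrm d\lambda_G=1$ (the result does not depend on $\omega$). Let $\mathrm F$ be the space of continuous maps $B:G\to G$ with $B_0=0$ such that $\xi_B:=(\mathrm{Id}+B)\circ\xi$ (the push-forward of $\xi$ by $t\mapsto t+B_t$) is in $\mathrm M$ for every $\xi\in\mathrm M$, with the $\sigma$-algebra generated by the evaluations $B\mapsto B_t$. A measure $\nu$ on $\mathrm F$ is weakly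 stationary if it is invariant under the maps $\theta_tB=(B_{t+s}-B_t)_{s\in G}$, $t\in G$. Let $\mathrm P$ be a $\sigma$-finite stationary measure on $\mathrm M$ which gives no mass to the zero measure, let $\nu$ be a $\sigma$-finite weakly stationary measure on $\mathrm F$, and let $\mathrm P_0^\nu$ be the push-forward of $\mathrm P_0\otimes\nu$ by $(\xi,B)\mapsto\xi_B$. Assume that $\mathrm P_0^\nu$ is $\sigma$-finite. Then there is exactly one $\sigma$-finite stationary measure $\mathrm P^\nu$ on $\mathrm M$ which gives no mass to the zero measure and has Palm measure $\mathrm P_0^\nu$, and $$\mathrm P^\nu(\mathrm M)=\mathrm P(\mathrm M)\cdot\nu(\mathrm F)$$ in $[0,\infty]$, with the convention $0\cdot\infty=0$. In particular, if $\mathrm P\neq0$ and $\nu\neq0$, then $\mathrm P^\nu$ is finite if and only if both $\mathrm P$ and $\nu$ are finite. -/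

import Mathlib

open MeasureTheory Set
open scoped ENNReal NNReal

set_option linter.unusedSectionVars false

namespace Palm

section Spaces

variable (G : Type*) [TopologicalSpace G] [MeasurableSpace G]

/-- `M(G)`: the positive measures on `G` which are finite on compact sets. -/
def LocFinMeasure : Type _ :=
  {ξ : Measure G // ∀ K : Set G, IsCompact K → ξ K < ∞}

variable {G}

/-- A locally finite measure, seen as a measure. -/
def LocFinMeasure.toMeasure (ξ : LocFinMeasure G) : Measure G := ξ.1

theorem LocFinMeasure.lt_top (ξ : LocFinMeasure G) {K : Set G} (hK : IsCompact K) :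
    ξ.toMeasure K < ∞ := ξ.2 K hK

variable (G)

/-- The `σ`-algebra on `M(G)` generated by the maps `ξ ↦ ξ(K)`, `K` compact. -/
instance LocFinMeasure.instMeasurableSpace : MeasurableSpace (LocFinMeasure G) :=
  ⨆ (K : Set G) (_ : IsCompact K),
    MeasurableSpace.comap (fun ξ : LocFinMeasure G => ξ.toMeasure K) inferInstance

variable [AddCommGroup G]

/-- `F(G)`: the continuous maps `B : G → G` with `B 0 = 0` such that the image of every locally
finite measure under `t ↦ t + B t` is locally finite. -/
def Displacement : Type _ :=
  {B : G → G // Continuous B ∧ B 0 = 0 ∧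
    ∀ (ξ : LocFinMeasure G) (K : Set G), IsCompact K →
      (ξ.toMeasure.map fun t => t + B t) K < ∞}

/-- The cylindrical `σ`-algebra on `F(G)`, generated by the evaluations `B ↦ B t`. -/
instance Displacement.instMeasurableSpace : MeasurableSpace (Displacement G) :=
  ⨆ t : G, MeasurableSpace.comap (fun B : Displacement G => B.1 t) inferInstance

end Spaces

section Defs

variable {G : Type*} [AddCommGroup G] [TopologicalSpace G] [IsTopologicalAddGroup G]
  [T2Space G] [LocallyCompactSpace G] [SecondCountableTopology G]
  [MeasurableSpace G] [BorelSpace G]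

theorem translate_aux (t : G) (ξ : LocFinMeasure G) (K : Set G) (hK : IsCompact K) :
    (ξ.toMeasure.map fun s => s - t) K < ∞ := by
  rw [Measure.map_apply (by fun_prop) hK.measurableSet]
  exact ξ.2 _ ((Homeomorph.subRight t).isCompact_preimage.2 hK)

/-- The translation `τ_t ξ = ξ(· + t)`, i.e. `(τ_t ξ)(A) = ξ(A + t)`. -/
noncomputable def translate (t : G) (ξ : LocFinMeasure G) : LocFinMeasure G :=
  ⟨ξ.toMeasure.map fun s => s - t, translate_aux t ξ⟩

theorem increment_aux (t : G) (B : Displacement G) :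
    Continuous (fun s => B.1 (t + s) - B.1 t) ∧ B.1 (t + 0) - B.1 t = 0 ∧
    ∀ (ξ : LocFinMeasure G) (K : Set G), IsCompact K →
      (ξ.toMeasure.map fun s => s + (B.1 (t + s) - B.1 t)) K < ∞ := by
  have hB := B.2.1
  refine ⟨by fun_prop, by simp, fun ξ K hK => ?_⟩
  have h : ((ξ.toMeasure.map fun s => s - -t).map fun s => s + B.1 s)
      (Homeomorph.subRight (t + B.1 t) ⁻¹' K) < ∞ := B.2.2.2 (translate (-t) ξ) _
    ((Homeomorph.subRight (t + B.1 t)).isCompact_preimage.2 hK)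
  have hm : Measurable fun s => s + B.1 s := (continuous_id.add hB).measurable
  rw [Measure.map_map hm (by fun_prop),
    Measure.map_apply (hm.comp (by fun_prop))
      ((Homeomorph.subRight (t + B.1 t)).isCompact_preimage.2 hK).measurableSet] at h
  rw [Measure.map_apply (Continuous.measurable (by fun_prop)) hK.measurableSet]
  convert h using 2
  ext s
  have : s + (B.1 (t + s) - B.1 t) = s - -t + B.1 (s - -t) - (t + B.1 t) := by
    rw [sub_neg_eq_add, add_comm s t]; abel
  simp [this]

/-- `θ_t B = (B_{t+s} - B_t)_s`. -/
def increment (t : G) (B : Displacement G) : Displacement G :=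
  ⟨fun s => B.1 (t + s) - B.1 t, increment_aux t B⟩

/-- `Γ(ξ, B) = ξ_B`, the push-forward of `ξ` by `Id + B`. -/
noncomputable def displace (p : LocFinMeasure G × Displacement G) : LocFinMeasure G :=
  ⟨p.1.toMeasure.map fun t => t + p.2.1 t, fun K hK => p.2.2.2.2 p.1 K hK⟩

/-- A measure `P` on `M(G)` is stationary: `τ_t ∘ P = P` for all `t`. -/
def IsStationary (P : Measure (LocFinMeasure G)) : Prop :=
  ∀ t : G, P.map (translate t) = P

/-- A measure `ν` on `F(G)` is weakly stationary: `θ_t ∘ ν = ν` for all `t`. -/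
def IsWeaklyStationary (ν : Measure (Displacement G)) : Prop :=
  ∀ t : G, ν.map (increment t) = ν

/-- A weight: a measurable `ω : G → ℝ₊` of total integral one for the Haar measure `lam`. -/
def IsWeight (lam : Measure G) (ω : G → ℝ≥0) : Prop :=
  Measurable ω ∧ ∫⁻ t, (ω t : ℝ≥0∞) ∂lam = 1

/-- The Palm measure of `P`, computed with the weight `ω`:
`P₀(A) = ∫_M ∫_G ω(t) 1(τ_t ξ ∈ A) ξ(dt) P(dξ)`; see `palmMeasure_apply`. -/
noncomputable def palmMeasure (ω : G → ℝ≥0) (P : Measure (LocFinMeasure G)) :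
    Measure (LocFinMeasure G) :=
  P.bind fun ξ =>
    (ξ.toMeasure.withDensity fun t => (ω t : ℝ≥0∞)).map fun t => translate t ξ

/-- `R^ν = Γ ∘ (R ⊗ ν)`, the perturbation by `ν` of the measure `R` on `M(G)`. -/
noncomputable def perturb (R : Measure (LocFinMeasure G)) (ν : Measure (Displacement G)) :
    Measure (LocFinMeasure G) :=
  (R.prod ν).map displace

/-- `Q` is a `σ`-finite stationary measure on `M(G)` without mass at the zero measure, and `R` is
its Palm measure (with respect to the Haar measure `lam`). -/
structure IsStationaryWithPalm (lam : Measure G) (Q R : Measure (LocFinMeasure G)) : Prop where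
  sigmaFinite : SigmaFinite Q
  stationary : IsStationary Q
  null_zero : Q {ξ | ξ.toMeasure = 0} = 0
  palm : ∀ ω : G → ℝ≥0, IsWeight lam ω → palmMeasure ω Q = R

/-! Measurability facts showing that the push-forwards and the mixture above are genuine. -/

theorem measurable_apply_compact {K : Set G} (hK : IsCompact K) :
    Measurable fun ξ : LocFinMeasure G => ξ.toMeasure K := by
  rw [measurable_iff_comap_le]
  exact le_iSup₂_of_le K hK le_rfl

theorem measurable_to_locFin {α : Type*} [MeasurableSpace α] {f : α → LocFinMeasure G}
    (hf : ∀ K : Set G, IsCompact K → Measurable fun a => (f a).toMeasure K) :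
    Measurable f := by
  rw [measurable_iff_comap_le, LocFinMeasure.instMeasurableSpace]
  simp only [MeasurableSpace.comap_iSup, MeasurableSpace.comap_comp, iSup_le_iff]
  intro K hK
  exact measurable_iff_comap_le.1 (hf K hK)

theorem measurable_toMeasure :
    Measurable (LocFinMeasure.toMeasure : LocFinMeasure G → Measure G) := by
  have key : ∀ (n : ℕ) (A : Set G), MeasurableSet A →
      Measurable fun ξ : LocFinMeasure G => ξ.toMeasure (A ∩ compactCovering G n) := by
    intro n A hA
    have hc := isCompact_compactCovering G n
    induction A, hA using MeasurableSpace.induction_on_inter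
      ((BorelSpace.measurable_eq (α := G)).trans borel_eq_generateFrom_isClosed)
      isPiSystem_isClosed with
    | empty => simp
    | basic A hA => exact measurable_apply_compact (hc.inter_left hA)
    | compl A hA ih =>
      have : ∀ ξ : LocFinMeasure G, ξ.toMeasure (Aᶜ ∩ compactCovering G n) =
          ξ.toMeasure (compactCovering G n) - ξ.toMeasure (A ∩ compactCovering G n) := by
        intro ξ
        rw [← measure_sdiff inter_subset_right
          (hA.inter hc.measurableSet).nullMeasurableSet
          ((measure_mono inter_subset_right).trans_lt (ξ.lt_top hc)).ne]
        congr 1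
        ext x
        simp only [mem_inter_iff, mem_compl_iff, mem_sdiff]
        tauto
      simp only [this]
      exact (measurable_apply_compact hc).sub ih
    | iUnion f hd hf ih =>
      have : ∀ ξ : LocFinMeasure G, ξ.toMeasure ((⋃ i, f i) ∩ compactCovering G n) =
          ∑' i, ξ.toMeasure (f i ∩ compactCovering G n) := by
        intro ξ
        rw [iUnion_inter, measure_iUnion]
        · intro i j hij
          exact (hd hij).mono inter_subset_left inter_subset_left
        · exact fun i => (hf i).inter hc.measurableSet
      simp only [this]
      exact Measurable.tsum ih
  refine Measure.measurable_of_measurable_coe _ fun A hA => ?_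
  have : ∀ ξ : LocFinMeasure G, ξ.toMeasure A =
      ⨆ n, ξ.toMeasure (A ∩ compactCovering G n) := by
    intro ξ
    rw [← Monotone.measure_iUnion, ← inter_iUnion, iUnion_compactCovering, inter_univ]
    exact fun i j hij => inter_subset_inter_right _ (compactCovering_subset G hij)
  simp only [this]
  exact Measurable.iSup fun n => key n A hA

/-- Integrating a jointly measurable function against `ξ` is measurable. -/
theorem measurable_lintegral_locFin {α : Type*} [MeasurableSpace α] {g : α → LocFinMeasure G}
    (hg : Measurable g) {f : α → G → ℝ≥0∞} (hf : Measurable (Function.uncurry f)) :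
    Measurable fun a => ∫⁻ t, f a t ∂(g a).toMeasure := by
  have hm : Measurable fun a => (g a).toMeasure := measurable_toMeasure.comp hg
  have key : ∀ (n : ℕ) (S : Set (α × G)), MeasurableSet S →
      Measurable fun a => (g a).toMeasure (Prod.mk a ⁻¹' S ∩ compactCovering G n) := by
    intro n S hS
    have hc := isCompact_compactCovering G n
    have hcov : Measurable fun a => (g a).toMeasure (compactCovering G n) :=
      (Measure.measurable_coe hc.measurableSet).comp hm
    induction S, hS using MeasurableSpace.induction_on_inter
      generateFrom_prod.symm isPiSystem_prod with
    | empty => simp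
    | basic S hS =>
      obtain ⟨A, hA, B, hB, rfl⟩ := hS
      have : (fun a => (g a).toMeasure (Prod.mk a ⁻¹' (A ×ˢ B) ∩ compactCovering G n)) =
          A.indicator fun a => (g a).toMeasure (B ∩ compactCovering G n) := by
        ext a
        by_cases h : a ∈ A <;> simp [h]
      rw [this]
      exact ((Measure.measurable_coe (MeasurableSet.inter hB hc.measurableSet)).comp hm).indicator hA
    | compl S hS ih =>
      have : ∀ a, (g a).toMeasure (Prod.mk a ⁻¹' Sᶜ ∩ compactCovering G n) =
          (g a).toMeasure (compactCovering G n) -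
            (g a).toMeasure (Prod.mk a ⁻¹' S ∩ compactCovering G n) := by
        intro a
        rw [← measure_sdiff inter_subset_right
          ((measurable_prodMk_left hS).inter hc.measurableSet).nullMeasurableSet
          ((measure_mono inter_subset_right).trans_lt ((g a).lt_top hc)).ne]
        congr 1
        ext x
        simp only [mem_inter_iff, mem_preimage, mem_compl_iff, mem_sdiff]
        tauto
      simp only [this]
      exact hcov.sub ih
    | iUnion f hd hf ih =>
      have : ∀ a, (g a).toMeasure (Prod.mk a ⁻¹' (⋃ i, f i) ∩ compactCovering G n) =
          ∑' i, (g a).toMeasure (Prod.mk a ⁻¹' f i ∩ compactCovering G n) := by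
        intro a
        rw [preimage_iUnion, iUnion_inter, measure_iUnion]
        · intro i j hij
          exact ((hd hij).preimage _).mono inter_subset_left inter_subset_left
        · exact fun i => (measurable_prodMk_left (hf i)).inter hc.measurableSet
      simp only [this]
      exact Measurable.tsum ih
  have key' : ∀ S : Set (α × G), MeasurableSet S →
      Measurable fun a => (g a).toMeasure (Prod.mk a ⁻¹' S) := by
    intro S hS
    have : ∀ a, (g a).toMeasure (Prod.mk a ⁻¹' S) =
        ⨆ n, (g a).toMeasure (Prod.mk a ⁻¹' S ∩ compactCovering G n) := by
      intro a
      rw [← Monotone.measure_iUnion, ← inter_iUnion, iUnion_compactCovering, inter_univ]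
      exact fun i j hij => inter_subset_inter_right _ (compactCovering_subset G hij)
    simp only [this]
    exact Measurable.iSup fun n => key n S hS
  have main : ∀ F : α × G → ℝ≥0∞, Measurable F →
      Measurable fun a => ∫⁻ t, F (a, t) ∂(g a).toMeasure := by
    intro F hF
    refine Measurable.ennreal_induction
      (motive := fun F => Measurable fun a => ∫⁻ t, F (a, t) ∂(g a).toMeasure) ?_ ?_ ?_ hF
    · intro c S hS
      have : ∀ a, ∫⁻ t, S.indicator (fun _ => c) (a, t) ∂(g a).toMeasure =
          c * (g a).toMeasure (Prod.mk a ⁻¹' S) := by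
        intro a
        rw [← lintegral_indicator_const (measurable_prodMk_left hS)]
        rfl
      simp only [this]
      exact (key' S hS).const_mul c
    · intro f₁ f₂ _ h₁ _ i₁ i₂
      have : ∀ a, ∫⁻ t, (f₁ + f₂) (a, t) ∂(g a).toMeasure =
          ∫⁻ t, f₁ (a, t) ∂(g a).toMeasure + ∫⁻ t, f₂ (a, t) ∂(g a).toMeasure := by
        intro a
        exact lintegral_add_left (h₁.comp measurable_prodMk_left) _
      simp only [this]
      exact i₁.add i₂
    · intro f hf hmono ih
      have : ∀ a, ∫⁻ t, (⨆ n, f n (a, t)) ∂(g a).toMeasure =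
          ⨆ n, ∫⁻ t, f n (a, t) ∂(g a).toMeasure := by
        intro a
        exact lintegral_iSup (fun n => (hf n).comp measurable_prodMk_left)
          (fun i j hij t => hmono hij (a, t))
      simp only [this]
      exact Measurable.iSup ih
  exact main _ hf

theorem measurable_translate_uncurry :
    Measurable fun p : LocFinMeasure G × G => translate p.2 p.1 := by
  refine measurable_to_locFin fun K hK => ?_
  have : ∀ p : LocFinMeasure G × G, (translate p.2 p.1).toMeasure K =
      ∫⁻ s, K.indicator 1 (s - p.2) ∂p.1.toMeasure := by
    intro p
    change (p.1.toMeasure.map fun s => s - p.2) K = _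
    rw [Measure.map_apply (by fun_prop) hK.measurableSet,
      ← lintegral_indicator_one (hK.measurableSet.preimage (by fun_prop))]
    rfl
  simp only [this]
  refine measurable_lintegral_locFin measurable_fst ?_
  exact (measurable_one.indicator hK.measurableSet).comp
    (measurable_snd.sub (measurable_snd.comp measurable_fst))

theorem measurable_translate (t : G) : Measurable (translate t) :=
  measurable_translate_uncurry.comp measurable_prodMk_right

theorem measurable_eval (t : G) : Measurable fun B : Displacement G => B.1 t := by
  rw [measurable_iff_comap_le]
  exact le_iSup_of_le t le_rfl

theorem measurable_increment (t : G) : Measurable (increment t) := by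
  rw [measurable_iff_comap_le, Displacement.instMeasurableSpace]
  simp only [MeasurableSpace.comap_iSup, MeasurableSpace.comap_comp, iSup_le_iff]
  intro s
  exact measurable_iff_comap_le.1 ((measurable_eval (t + s)).sub (measurable_eval t))

/-- `(B, t) ↦ B t` is jointly measurable. -/
theorem measurable_eval_uncurry : Measurable fun p : Displacement G × G => p.1.1 p.2 := by
  have h := measurable_uncurry_of_continuous_of_measurable
    (u := fun (t : G) (B : Displacement G) => B.1 t) (fun B => B.2.1) measurable_eval
  exact h.comp measurable_swap

/-- `Γ` is measurable. -/
theorem measurable_displace :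
    Measurable (displace : LocFinMeasure G × Displacement G → LocFinMeasure G) := by
  refine measurable_to_locFin fun K hK => ?_
  have : ∀ p : LocFinMeasure G × Displacement G, (displace p).toMeasure K =
      ∫⁻ t, K.indicator 1 (t + p.2.1 t) ∂p.1.toMeasure := by
    intro p
    have hp : Measurable fun t => t + p.2.1 t := (continuous_id.add p.2.2.1).measurable
    change (p.1.toMeasure.map fun t => t + p.2.1 t) K = _
    rw [Measure.map_apply hp hK.measurableSet,
      ← lintegral_indicator_one (hK.measurableSet.preimage hp)]
    rfl
  simp only [this]
  refine measurable_lintegral_locFin measurable_fst ?_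
  exact (measurable_one.indicator hK.measurableSet).comp
    (measurable_snd.add (measurable_eval_uncurry.comp
      ((measurable_snd.comp measurable_fst).prodMk measurable_snd)))

/-- The defining formula of the Palm measure. -/
theorem palmMeasure_apply {ω : G → ℝ≥0} (hω : Measurable ω) (P : Measure (LocFinMeasure G))
    {A : Set (LocFinMeasure G)} (hA : MeasurableSet A) :
    palmMeasure ω P A =
      ∫⁻ ξ, ∫⁻ t, (ω t : ℝ≥0∞) * A.indicator 1 (translate t ξ) ∂ξ.toMeasure ∂P := by
  have hω' : Measurable fun t => (ω t : ℝ≥0∞) := hω.coe_nnreal_ennreal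
  have h : ∀ (C : Set (LocFinMeasure G)), MeasurableSet C → ∀ ξ : LocFinMeasure G,
      ((ξ.toMeasure.withDensity fun t => (ω t : ℝ≥0∞)).map fun t => translate t ξ) C =
        ∫⁻ t, (ω t : ℝ≥0∞) * C.indicator 1 (translate t ξ) ∂ξ.toMeasure := by
    intro C hC ξ
    have hξ : Measurable fun t => translate t ξ :=
      measurable_translate_uncurry.comp measurable_prodMk_left
    rw [Measure.map_apply hξ hC, withDensity_apply _ (hC.preimage hξ),
      ← lintegral_indicator (hC.preimage hξ)]
    refine lintegral_congr fun t => ?_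
    by_cases ht : translate t ξ ∈ C <;> simp [ht]
  rw [palmMeasure, Measure.bind_apply hA]
  · exact lintegral_congr fun ξ => h A hA ξ
  · refine (Measure.measurable_of_measurable_coe _ fun C hC => ?_).aemeasurable
    simp only [h C hC]
    refine measurable_lintegral_locFin measurable_id ?_
    exact (hω'.comp measurable_snd).mul
      ((measurable_one.indicator hC).comp measurable_translate_uncurry)

end Defs

end Palm

/-!
Write `|ξ| = ξ(G)`, which is finite and unchanged by translation since `G` is compact, and let `R₀`
be the Palm measure of a stationary `R`. Averaging the definition of `R₀` over all translations of
`ξ` removes the weight (`haar_mul_lintegral_palmMeasure`):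
`λ(G) ∫ f dR₀ = ∫∫ f(τ_t ξ) ξ(dt) R(dξ)`.

This has two consequences.

* Inversion (`lintegral_eq_lintegral_palm`): a stationary measure `Q` without mass at zero is
  determined by its Palm measure through `∫ g dQ = ∫ |ξ|⁻¹ ∫ g(τ_s ξ) λ(ds) Q₀(dξ)`. This gives
  uniqueness, and with `g = 1` it gives the total mass `Q(M) = λ(G) ∫ |ξ|⁻¹ Q₀(dξ)`. Since a
  displacement does not change `|ξ|`, the mass formula follows.
* The Mecke property (`MeckeInvariant`): re-rooting `ξ` at a point drawn from `ξ / |ξ|` preserves a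
  Palm measure. It is inherited by `P₀^ν` (`MeckeInvariant.perturb`), because
  `τ_{t + B_t} ξ_B = (τ_t ξ)_{θ_t B}` and `ν` is invariant under `θ_t`.

Conversely, for every measure `R` with the Mecke property and no mass at zero, the right-hand side
of the inversion formula defines a stationary measure with Palm measure `R`
(`palmMeasure_inversePalm`). It is `σ`-finite when `R` is: if `h > 0` has finite `R`-integral,
then `ξ ↦ ∫ h(τ_t ξ) ξ(dt)` is positive off zero and has finite integral.
-/

namespace Palm

section Compact

variable {G : Type*} [AddCommGroup G] [TopologicalSpace G] [IsTopologicalAddGroup G]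
  [T2Space G] [SecondCountableTopology G] [CompactSpace G] [MeasurableSpace G] [BorelSpace G]

/-! ### Translations and orbit integrals -/

instance LocFinMeasure.isFiniteMeasure (ξ : LocFinMeasure G) : IsFiniteMeasure ξ.toMeasure :=
  ⟨ξ.lt_top isCompact_univ⟩

theorem LocFinMeasure.ext {ξ η : LocFinMeasure G} (h : ξ.toMeasure = η.toMeasure) : ξ = η :=
  Subtype.ext h

theorem toMeasure_translate (t : G) (ξ : LocFinMeasure G) :
    (translate t ξ).toMeasure = ξ.toMeasure.map fun s => s - t := rfl

theorem toMeasure_displace (ξ : LocFinMeasure G) (B : Displacement G) :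
    (displace (ξ, B)).toMeasure = ξ.toMeasure.map fun t => t + B.1 t := rfl

theorem measurable_id_add_displacement (B : Displacement G) : Measurable fun t => t + B.1 t :=
  (continuous_id.add B.2.1).measurable

theorem translate_translate (s t : G) (ξ : LocFinMeasure G) :
    translate t (translate s ξ) = translate (s + t) ξ := by
  refine LocFinMeasure.ext ?_
  rw [toMeasure_translate, toMeasure_translate, toMeasure_translate,
    Measure.map_map (by fun_prop) (by fun_prop)]
  congr 1
  ext u
  simp [sub_sub]

theorem translate_mass (t : G) (ξ : LocFinMeasure G) :
    (translate t ξ).toMeasure univ = ξ.toMeasure univ := by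
  rw [toMeasure_translate, Measure.map_apply (by fun_prop) .univ, preimage_univ]

theorem translate_toMeasure_eq_zero {t : G} {ξ : LocFinMeasure G} :
    (translate t ξ).toMeasure = 0 ↔ ξ.toMeasure = 0 := by
  rw [← Measure.measure_univ_eq_zero, translate_mass, Measure.measure_univ_eq_zero]

theorem displace_mass (ξ : LocFinMeasure G) (B : Displacement G) :
    (displace (ξ, B)).toMeasure univ = ξ.toMeasure univ := by
  rw [toMeasure_displace, Measure.map_apply (measurable_id_add_displacement B) .univ,
    preimage_univ]

theorem displace_toMeasure_eq_zero {ξ : LocFinMeasure G} {B : Displacement G} :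
    (displace (ξ, B)).toMeasure = 0 ↔ ξ.toMeasure = 0 := by
  rw [← Measure.measure_univ_eq_zero, displace_mass, Measure.measure_univ_eq_zero]

/-- Recentring the displaced measure at the image of `t` amounts to recentring both the measure and
the displacement at `t`. -/
theorem translate_displace (t : G) (ξ : LocFinMeasure G) (B : Displacement G) :
    translate (t + B.1 t) (displace (ξ, B)) = displace (translate t ξ, increment t B) := by
  refine LocFinMeasure.ext ?_
  rw [toMeasure_translate, toMeasure_displace, toMeasure_displace, toMeasure_translate,
    Measure.map_map (by fun_prop) (measurable_id_add_displacement B),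
    Measure.map_map (measurable_id_add_displacement _) (by fun_prop)]
  congr 1
  ext s
  change s + B.1 s - (t + B.1 t) = s - t + (B.1 (t + (s - t)) - B.1 t)
  rw [add_sub_cancel]
  abel

theorem measurable_mass : Measurable fun ξ : LocFinMeasure G => ξ.toMeasure univ :=
  measurable_apply_compact isCompact_univ

theorem measurable_translate_left (ξ : LocFinMeasure G) : Measurable fun t => translate t ξ :=
  measurable_translate_uncurry.comp measurable_prodMk_left

theorem measurable_comp_translate {h : LocFinMeasure G → ℝ≥0∞} (hh : Measurable h)
    (ξ : LocFinMeasure G) : Measurable fun t => h (translate t ξ) :=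
  hh.comp (measurable_translate_left ξ)

theorem measurable_div_mass {g : LocFinMeasure G → ℝ≥0∞} (hg : Measurable g) :
    Measurable fun ξ => g ξ / ξ.toMeasure univ :=
  hg.div measurable_mass

theorem lintegral_toMeasure_translate {f : G → ℝ≥0∞} (hf : Measurable f) (t : G)
    (ξ : LocFinMeasure G) :
    ∫⁻ s, f s ∂(translate t ξ).toMeasure = ∫⁻ s, f (s - t) ∂ξ.toMeasure := by
  rw [toMeasure_translate, lintegral_map hf (by fun_prop)]

/-- The sum `∫ h(τ_t ξ) ξ(dt)` of `h` over all re-rootings of `ξ` at its own points. -/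
noncomputable def orbitIntegral (h : LocFinMeasure G → ℝ≥0∞) (ξ : LocFinMeasure G) : ℝ≥0∞ :=
  ∫⁻ t, h (translate t ξ) ∂ξ.toMeasure

/-- The average `∫ g(τ_s ξ) λ(ds)` of `g` along the orbit of `ξ`, not normalized. -/
noncomputable def haarIntegral (lam : Measure G) (g : LocFinMeasure G → ℝ≥0∞)
    (ξ : LocFinMeasure G) : ℝ≥0∞ :=
  ∫⁻ s, g (translate s ξ) ∂lam

theorem measurable_orbitIntegral {h : LocFinMeasure G → ℝ≥0∞} (hh : Measurable h) :
    Measurable (orbitIntegral h) :=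
  measurable_lintegral_locFin measurable_id (f := fun ξ t => h (translate t ξ))
    (hh.comp measurable_translate_uncurry)

theorem measurable_haarIntegral {lam : Measure G} [SFinite lam] {g : LocFinMeasure G → ℝ≥0∞}
    (hg : Measurable g) : Measurable (haarIntegral lam g) :=
  Measurable.lintegral_prod_right' (f := fun p : LocFinMeasure G × G => g (translate p.2 p.1))
    (hg.comp measurable_translate_uncurry)

theorem orbitIntegral_translate {h : LocFinMeasure G → ℝ≥0∞} (hh : Measurable h) (s : G)
    (ξ : LocFinMeasure G) : orbitIntegral h (translate s ξ) = orbitIntegral h ξ := by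
  rw [orbitIntegral, lintegral_toMeasure_translate (measurable_comp_translate hh _)]
  simp [translate_translate, orbitIntegral]

theorem haarIntegral_translate {lam : Measure G} [lam.IsAddHaarMeasure]
    (g : LocFinMeasure G → ℝ≥0∞) (s : G) (ξ : LocFinMeasure G) :
    haarIntegral lam g (translate s ξ) = haarIntegral lam g ξ := by
  simp only [haarIntegral, translate_translate]
  exact lintegral_add_left_eq_self (fun t => g (translate t ξ)) s

/-- If `F` is translation invariant, its orbit integral is `F(ξ) |ξ|`. -/
theorem orbitIntegral_of_invariant {F : LocFinMeasure G → ℝ≥0∞}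
    (hF : ∀ t ξ, F (translate t ξ) = F ξ) (ξ : LocFinMeasure G) :
    orbitIntegral F ξ = F ξ * ξ.toMeasure univ := by
  simp [orbitIntegral, hF]

/-- Division by `|ξ|` can be undone when the numerator vanishes at `ξ = 0`, as it does for orbit
integrals. -/
theorem orbitIntegral_div_mul_mass (h : LocFinMeasure G → ℝ≥0∞) (ξ : LocFinMeasure G) :
    orbitIntegral h ξ / ξ.toMeasure univ * ξ.toMeasure univ = orbitIntegral h ξ := by
  by_cases h0 : ξ.toMeasure univ = 0
  · rw [h0, mul_zero, orbitIntegral, Measure.measure_univ_eq_zero.1 h0, lintegral_zero_measure]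
  · exact ENNReal.div_mul_cancel h0 (measure_ne_top _ _)

theorem ae_toMeasure_ne_zero {Q : Measure (LocFinMeasure G)} (h : Q {ξ | ξ.toMeasure = 0} = 0) :
    ∀ᵐ ξ ∂Q, ξ.toMeasure ≠ 0 := by
  simpa [ae_iff] using h

theorem measurableSet_toMeasure_eq_zero :
    MeasurableSet {ξ : LocFinMeasure G | ξ.toMeasure = 0} := by
  have : {ξ : LocFinMeasure G | ξ.toMeasure = 0} =
      (fun ξ : LocFinMeasure G => ξ.toMeasure univ) ⁻¹' {0} := by
    ext ξ
    simp
  rw [this]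
  exact measurable_mass (measurableSet_singleton 0)

/-! ### The Palm measure of a stationary measure -/

theorem lintegral_palmMeasure {ω : G → ℝ≥0} (hω : Measurable ω) (P : Measure (LocFinMeasure G))
    {f : LocFinMeasure G → ℝ≥0∞} (hf : Measurable f) :
    ∫⁻ ξ, f ξ ∂palmMeasure ω P =
      ∫⁻ ξ, ∫⁻ t, (ω t : ℝ≥0∞) * f (translate t ξ) ∂ξ.toMeasure ∂P := by
  have hω' : Measurable fun t => (ω t : ℝ≥0∞) := hω.coe_nnreal_ennreal
  have h : ∀ g : LocFinMeasure G → ℝ≥0∞, Measurable g → ∀ ξ : LocFinMeasure G,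
      ∫⁻ η, g η ∂((ξ.toMeasure.withDensity fun t => (ω t : ℝ≥0∞)).map fun t => translate t ξ) =
        ∫⁻ t, (ω t : ℝ≥0∞) * g (translate t ξ) ∂ξ.toMeasure := by
    intro g hg ξ
    rw [lintegral_map hg (measurable_translate_left ξ),
      lintegral_withDensity_eq_lintegral_mul _ hω' (measurable_comp_translate hg ξ)]
    rfl
  rw [palmMeasure, Measure.lintegral_bind _ hf.aemeasurable]
  · exact lintegral_congr fun ξ => h f hf ξ
  · refine (Measure.measurable_of_measurable_coe _ fun C hC => ?_).aemeasurable
    simp only [← lintegral_indicator_one hC, h _ (measurable_one.indicator hC)]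
    exact measurable_lintegral_locFin measurable_id ((hω'.comp measurable_snd).mul
      ((measurable_one.indicator hC).comp measurable_translate_uncurry))

theorem haar_mul_lintegral {lam : Measure G} [lam.IsAddHaarMeasure]
    {P : Measure (LocFinMeasure G)} [SFinite P] (hP : IsStationary P)
    {g : LocFinMeasure G → ℝ≥0∞} (hg : Measurable g) :
    lam univ * ∫⁻ ξ, g ξ ∂P = ∫⁻ ξ, haarIntegral lam g ξ ∂P := by
  unfold haarIntegral
  rw [lintegral_lintegral_swap (f := fun ξ s => g (translate s ξ))
    (hg.comp measurable_translate_uncurry).aemeasurable]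
  have : ∀ s : G, ∫⁻ ξ, g (translate s ξ) ∂P = ∫⁻ ξ, g ξ ∂P := by
    intro s
    rw [← lintegral_map hg (measurable_translate s), hP s]
  simp [this, mul_comm]

/-- Averaging the weighted sum over all translations of `ξ` removes the weight. -/
theorem haarIntegral_weighted {lam : Measure G} [lam.IsAddHaarMeasure] {ω : G → ℝ≥0}
    (hω : IsWeight lam ω) {f : LocFinMeasure G → ℝ≥0∞} (hf : Measurable f)
    (ξ : LocFinMeasure G) :
    haarIntegral lam (fun η => ∫⁻ t, (ω t : ℝ≥0∞) * f (translate t η) ∂η.toMeasure) ξ =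
      orbitIntegral f ξ := by
  have hω' : Measurable fun t => (ω t : ℝ≥0∞) := hω.1.coe_nnreal_ennreal
  have hfξ : Measurable fun t => f (translate t ξ) := measurable_comp_translate hf ξ
  have h1 : ∀ s, ∫⁻ t, (ω t : ℝ≥0∞) * f (translate t (translate s ξ))
      ∂(translate s ξ).toMeasure = ∫⁻ t, (ω (t - s) : ℝ≥0∞) * f (translate t ξ) ∂ξ.toMeasure := by
    intro s
    rw [lintegral_toMeasure_translate
      (f := fun t => (ω t : ℝ≥0∞) * f (translate t (translate s ξ)))
      (hω'.mul (measurable_comp_translate hf _))]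
    simp [translate_translate]
  simp only [haarIntegral, h1]
  rw [lintegral_lintegral_swap]
  · refine lintegral_congr fun t => ?_
    rw [lintegral_mul_const _ (f := fun s => (ω (t - s) : ℝ≥0∞))
        (hω'.comp (measurable_const.sub measurable_id)),
      lintegral_sub_left_eq_self (fun s => (ω s : ℝ≥0∞)) t, hω.2, one_mul]
  · exact ((hω'.comp (measurable_snd.sub measurable_fst)).mul
      (hfξ.comp measurable_snd)).aemeasurable

theorem measurable_weighted {ω : G → ℝ≥0} (hω : Measurable ω) {f : LocFinMeasure G → ℝ≥0∞}
    (hf : Measurable f) :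
    Measurable fun ξ : LocFinMeasure G =>
      ∫⁻ t, (ω t : ℝ≥0∞) * f (translate t ξ) ∂ξ.toMeasure :=
  measurable_lintegral_locFin measurable_id ((hω.coe_nnreal_ennreal.comp measurable_snd).mul
    (hf.comp measurable_translate_uncurry))

/-- The Palm measure of a stationary measure, freed from the weight. -/
theorem haar_mul_lintegral_palmMeasure {lam : Measure G} [lam.IsAddHaarMeasure] {ω : G → ℝ≥0}
    (hω : IsWeight lam ω) {P : Measure (LocFinMeasure G)} [SFinite P] (hP : IsStationary P)
    {f : LocFinMeasure G → ℝ≥0∞} (hf : Measurable f) :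
    lam univ * ∫⁻ ξ, f ξ ∂palmMeasure ω P = ∫⁻ ξ, orbitIntegral f ξ ∂P := by
  rw [lintegral_palmMeasure hω.1 P hf, haar_mul_lintegral hP (measurable_weighted hω.1 hf)]
  exact lintegral_congr fun ξ => haarIntegral_weighted hω hf ξ

theorem haar_univ_ne_zero (lam : Measure G) [lam.IsAddHaarMeasure] : lam univ ≠ 0 :=
  NeZero.ne _

/-- Inversion formula: a stationary measure without mass at zero is recovered from its Palm
measure. -/
theorem lintegral_eq_lintegral_palm {lam : Measure G} [lam.IsAddHaarMeasure] {ω : G → ℝ≥0}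
    (hω : IsWeight lam ω) {Q : Measure (LocFinMeasure G)} [SFinite Q] (hQ : IsStationary Q)
    (hQ0 : Q {ξ | ξ.toMeasure = 0} = 0) {g : LocFinMeasure G → ℝ≥0∞} (hg : Measurable g) :
    ∫⁻ ξ, g ξ ∂Q = ∫⁻ ξ, haarIntegral lam g ξ / ξ.toMeasure univ ∂palmMeasure ω Q := by
  rw [← ENNReal.mul_right_inj (haar_univ_ne_zero lam) (measure_ne_top lam univ),
    haar_mul_lintegral hQ hg,
    haar_mul_lintegral_palmMeasure hω hQ (measurable_div_mass (measurable_haarIntegral hg))]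
  refine lintegral_congr_ae ?_
  filter_upwards [ae_toMeasure_ne_zero hQ0] with ξ hξ
  rw [orbitIntegral_of_invariant fun t η => by rw [haarIntegral_translate, translate_mass],
    ENNReal.div_mul_cancel (mt Measure.measure_univ_eq_zero.1 hξ) (measure_ne_top _ _)]

theorem palmMeasure_null_zero {ω : G → ℝ≥0} (hω : Measurable ω)
    (P : Measure (LocFinMeasure G)) : palmMeasure ω P {ξ | ξ.toMeasure = 0} = 0 := by
  rw [palmMeasure_apply hω P measurableSet_toMeasure_eq_zero]
  refine (lintegral_congr fun ξ => ?_).trans lintegral_zero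
  -- At `ξ = 0` the inner integral vanishes; elsewhere no translate of `ξ` is zero.
  by_cases h0 : ξ.toMeasure = 0
  · rw [h0, lintegral_zero_measure]
  · simp [indicator, translate_toMeasure_eq_zero, h0]

/-! ### The Mecke property -/

/-- Re-rooting `ξ` at a point chosen according to `ξ / |ξ|` preserves `R`. -/
def MeckeInvariant (R : Measure (LocFinMeasure G)) : Prop :=
  ∀ h : LocFinMeasure G → ℝ≥0∞, Measurable h →
    ∫⁻ ξ, orbitIntegral h ξ / ξ.toMeasure univ ∂ R = ∫⁻ ξ, h ξ ∂ R

theorem meckeInvariant_palmMeasure {lam : Measure G} [lam.IsAddHaarMeasure] {ω : G → ℝ≥0}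
    (hω : IsWeight lam ω) {P : Measure (LocFinMeasure G)} [SFinite P] (hP : IsStationary P) :
    MeckeInvariant (palmMeasure ω P) := by
  intro h hh
  rw [← ENNReal.mul_right_inj (haar_univ_ne_zero lam) (measure_ne_top lam univ),
    haar_mul_lintegral_palmMeasure hω hP (measurable_div_mass (measurable_orbitIntegral hh)),
    haar_mul_lintegral_palmMeasure hω hP hh]
  refine lintegral_congr fun ξ => ?_
  rw [orbitIntegral_of_invariant fun t η => by rw [orbitIntegral_translate hh, translate_mass],
    orbitIntegral_div_mul_mass]

theorem lintegral_perturb (R : Measure (LocFinMeasure G)) (ν : Measure (Displacement G))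
    [SFinite ν] {f : LocFinMeasure G → ℝ≥0∞} (hf : Measurable f) :
    ∫⁻ ξ, f ξ ∂perturb R ν = ∫⁻ ξ, ∫⁻ B, f (displace (ξ, B)) ∂ν ∂ R := by
  rw [perturb, lintegral_map hf measurable_displace,
    lintegral_prod (fun p => f (displace p)) (hf.comp measurable_displace).aemeasurable]

theorem measurable_increment_uncurry :
    Measurable fun p : G × Displacement G => increment p.1 p.2 := by
  rw [measurable_iff_comap_le, Displacement.instMeasurableSpace]
  simp only [MeasurableSpace.comap_iSup, MeasurableSpace.comap_comp, iSup_le_iff]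
  intro s
  refine measurable_iff_comap_le.1 ?_
  exact (measurable_eval_uncurry.comp (measurable_snd.prodMk (measurable_fst.add_const s))).sub
    (measurable_eval_uncurry.comp (measurable_snd.prodMk measurable_fst))

theorem MeckeInvariant.perturb {R : Measure (LocFinMeasure G)} (hR : MeckeInvariant R)
    {ν : Measure (Displacement G)} [SFinite ν] (hν : IsWeaklyStationary ν) :
    MeckeInvariant (perturb R ν) := by
  intro f hf
  have hfd : Measurable fun p : LocFinMeasure G × Displacement G => f (displace p) :=
    hf.comp measurable_displace
  rw [lintegral_perturb R ν (measurable_div_mass (measurable_orbitIntegral hf)),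
    lintegral_perturb R ν hf,
    ← hR (fun ξ => ∫⁻ B, f (displace (ξ, B)) ∂ν) hfd.lintegral_prod_right']
  refine lintegral_congr fun ξ => ?_
  have hm : Measurable (Function.uncurry fun (B : Displacement G) (t : G) =>
      f (displace (translate t ξ, increment t B))) :=
    hfd.comp (((measurable_translate_left ξ).comp measurable_snd).prodMk
      (measurable_increment_uncurry.comp measurable_swap))
  have h1 : ∀ B : Displacement G, orbitIntegral f (displace (ξ, B)) =
      ∫⁻ t, f (displace (translate t ξ, increment t B)) ∂ξ.toMeasure := by
    intro B
    rw [orbitIntegral, toMeasure_displace,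
      lintegral_map (measurable_comp_translate hf _) (measurable_id_add_displacement B)]
    simp only [translate_displace]
  have h2 : ∀ t, ∫⁻ B, f (displace (translate t ξ, increment t B)) ∂ν =
      ∫⁻ B, f (displace (translate t ξ, B)) ∂ν := by
    intro t
    rw [← lintegral_map (f := fun B => f (displace (translate t ξ, B)))
      (hfd.comp measurable_prodMk_left) (measurable_increment t), hν t]
  simp only [displace_mass, h1, div_eq_mul_inv]
  have hm' : Measurable fun B : Displacement G =>
      ∫⁻ t, f (displace (translate t ξ, increment t B)) ∂ξ.toMeasure := hm.lintegral_prod_right'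
  rw [lintegral_mul_const _ hm', lintegral_lintegral_swap hm.aemeasurable]
  simp only [h2, orbitIntegral]

theorem perturb_null_zero {R : Measure (LocFinMeasure G)} (hR : R {ξ | ξ.toMeasure = 0} = 0)
    (ν : Measure (Displacement G)) [SFinite ν] :
    perturb R ν {ξ | ξ.toMeasure = 0} = 0 := by
  rw [← lintegral_indicator_one measurableSet_toMeasure_eq_zero,
    lintegral_perturb R ν (measurable_one.indicator measurableSet_toMeasure_eq_zero),
    ← lintegral_zero (μ := R)]
  refine lintegral_congr_ae ?_
  filter_upwards [ae_toMeasure_ne_zero hR] with ξ hξ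
  simp [indicator, displace_toMeasure_eq_zero, hξ]

/-! ### The stationary measure with a given Palm measure -/

/-- The measure `Q` with `∫ g dQ = ∫ |ξ|⁻¹ ∫ g(τ_s ξ) λ(ds) R(dξ)`. -/
noncomputable def inversePalm (lam : Measure G) (R : Measure (LocFinMeasure G)) :
    Measure (LocFinMeasure G) :=
  ((R.withDensity fun ξ => (ξ.toMeasure univ)⁻¹).prod lam).map fun p => translate p.2 p.1

theorem lintegral_inversePalm (lam : Measure G) [SFinite lam] (R : Measure (LocFinMeasure G))
    {g : LocFinMeasure G → ℝ≥0∞} (hg : Measurable g) :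
    ∫⁻ ξ, g ξ ∂inversePalm lam R = ∫⁻ ξ, haarIntegral lam g ξ / ξ.toMeasure univ ∂ R := by
  rw [inversePalm, lintegral_map hg measurable_translate_uncurry,
    lintegral_prod (fun p : LocFinMeasure G × G => g (translate p.2 p.1))
      (hg.comp measurable_translate_uncurry).aemeasurable]
  change ∫⁻ ξ, haarIntegral lam g ξ ∂ (R.withDensity _) = _
  rw [lintegral_withDensity_eq_lintegral_mul _ (f := fun ξ => (ξ.toMeasure univ)⁻¹)
      measurable_mass.inv
      (measurable_haarIntegral (lam := lam) hg)]
  refine lintegral_congr fun ξ => ?_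
  rw [Pi.mul_apply, mul_comm, div_eq_mul_inv]

theorem isStationary_inversePalm (lam : Measure G) [lam.IsAddHaarMeasure]
    (R : Measure (LocFinMeasure G)) : IsStationary (inversePalm lam R) := by
  intro t
  refine Measure.ext_of_lintegral _ fun g hg => ?_
  rw [lintegral_map hg (measurable_translate t),
    lintegral_inversePalm lam R (g := fun ξ => g (translate t ξ))
      (hg.comp (measurable_translate t)),
    lintegral_inversePalm lam R hg]
  refine lintegral_congr fun ξ => ?_
  simp only [haarIntegral, translate_translate]
  rw [lintegral_add_right_eq_self (fun s => g (translate s ξ)) t]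

theorem inversePalm_null_zero (lam : Measure G) [SFinite lam] {R : Measure (LocFinMeasure G)}
    (hR : R {ξ | ξ.toMeasure = 0} = 0) : inversePalm lam R {ξ | ξ.toMeasure = 0} = 0 := by
  rw [← lintegral_indicator_one measurableSet_toMeasure_eq_zero,
    lintegral_inversePalm lam R (measurable_one.indicator measurableSet_toMeasure_eq_zero),
    ← lintegral_zero (μ := R)]
  refine lintegral_congr_ae ?_
  filter_upwards [ae_toMeasure_ne_zero hR] with ξ hξ
  simp [haarIntegral, indicator, translate_toMeasure_eq_zero, hξ]

theorem palmMeasure_inversePalm {lam : Measure G} [lam.IsAddHaarMeasure] {ω : G → ℝ≥0}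
    (hω : IsWeight lam ω) {R : Measure (LocFinMeasure G)} (hR : MeckeInvariant R) :
    palmMeasure ω (inversePalm lam R) = R := by
  refine Measure.ext_of_lintegral _ fun f hf => ?_
  rw [lintegral_palmMeasure hω.1 _ hf, lintegral_inversePalm _ _ (measurable_weighted hω.1 hf),
    ← hR f hf]
  exact lintegral_congr fun ξ => by rw [haarIntegral_weighted hω hf]

/-- A measure is `σ`-finite if a measurable function with finite integral vanishes only on a null
set. -/
theorem sigmaFinite_of_lintegral_ne_top {α : Type*} [MeasurableSpace α] {μ : Measure α}
    {g : α → ℝ≥0∞} (hg : Measurable g) (hfin : ∫⁻ a, g a ∂μ ≠ ∞) (h0 : μ {a | g a = 0} = 0) :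
    SigmaFinite μ := by
  refine ⟨⟨⟨fun n => {a | g a = 0} ∪ {a | ((n : ℝ≥0∞) + 1)⁻¹ ≤ g a}, fun _ => trivial,
    fun n => ?_, ?_⟩⟩⟩
  · refine (measure_union_le _ _).trans_lt ?_
    rw [h0, zero_add]
    have hne : ((n : ℝ≥0∞) + 1)⁻¹ ≠ 0 := by simp
    refine (meas_ge_le_lintegral_div hg.aemeasurable hne (by simp)).trans_lt ?_
    exact ENNReal.div_lt_top hfin hne
  · refine eq_univ_of_forall fun a => mem_iUnion.2 ?_
    by_cases ha : g a = 0
    · exact ⟨0, Or.inl ha⟩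
    · obtain ⟨n, hn⟩ := ENNReal.exists_inv_nat_lt ha
      exact ⟨n, Or.inr ((ENNReal.inv_le_inv.2 le_self_add).trans hn.le)⟩

theorem sigmaFinite_inversePalm (lam : Measure G) [lam.IsAddHaarMeasure]
    {R : Measure (LocFinMeasure G)} [SigmaFinite R] (hR : MeckeInvariant R)
    (hR0 : R {ξ | ξ.toMeasure = 0} = 0) : SigmaFinite (inversePalm lam R) := by
  obtain ⟨h, hpos, hh, hfin⟩ := exists_pos_lintegral_lt_of_sigmaFinite R one_ne_zero
  have hh' : Measurable fun ξ => (h ξ : ℝ≥0∞) := hh.coe_nnreal_ennreal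
  refine sigmaFinite_of_lintegral_ne_top (measurable_orbitIntegral hh') ?_ ?_
  · rw [lintegral_inversePalm lam R (measurable_orbitIntegral hh')]
    -- The orbit integral is constant along orbits, so averaging it multiplies it by `λ(G)`.
    have : ∀ ξ, haarIntegral lam (orbitIntegral fun ξ => (h ξ : ℝ≥0∞)) ξ / ξ.toMeasure univ =
        lam univ * (orbitIntegral (fun ξ => (h ξ : ℝ≥0∞)) ξ / ξ.toMeasure univ) := by
      intro ξ
      simp only [haarIntegral, orbitIntegral_translate hh', lintegral_const]
      rw [mul_comm, mul_div_assoc]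
    simp only [this]
    rw [lintegral_const_mul _ (measurable_div_mass (measurable_orbitIntegral hh')), hR _ hh']
    exact ENNReal.mul_ne_top (measure_ne_top _ _) (hfin.trans ENNReal.one_lt_top).ne
  · refine measure_mono_null (fun ξ hξ => ?_) (inversePalm_null_zero lam hR0)
    by_contra h0
    have hne : ξ.toMeasure ≠ 0 := h0
    have := (lintegral_eq_zero_iff (measurable_comp_translate hh' ξ)).1 hξ
    have hF : ∀ᵐ t ∂ξ.toMeasure, False := by
      filter_upwards [this] with t ht
      exact (hpos (translate t ξ)).ne' (by simpa using ht)
    exact hne (by simpa using hF)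

/-! ### Existence, uniqueness and total mass -/

theorem exists_isWeight (lam : Measure G) [lam.IsAddHaarMeasure] :
    ∃ ω : G → ℝ≥0, IsWeight lam ω := by
  refine ⟨fun _ => (lam univ)⁻¹.toNNReal, measurable_const, ?_⟩
  rw [lintegral_const,
    ENNReal.coe_toNNReal (ENNReal.inv_ne_top.2 (haar_univ_ne_zero lam)),
    ENNReal.inv_mul_cancel (haar_univ_ne_zero lam) (measure_ne_top _ _)]

theorem IsStationaryWithPalm.eq_inversePalm {lam : Measure G} [lam.IsAddHaarMeasure]
    {Q R : Measure (LocFinMeasure G)} (h : IsStationaryWithPalm lam Q R) :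
    Q = inversePalm lam R := by
  obtain ⟨ω, hω⟩ := exists_isWeight lam
  have := h.sigmaFinite
  refine Measure.ext_of_lintegral _ fun g hg => ?_
  rw [lintegral_eq_lintegral_palm hω h.stationary h.null_zero hg, h.palm ω hω,
    lintegral_inversePalm lam R hg]

theorem isStationaryWithPalm_inversePalm (lam : Measure G) [lam.IsAddHaarMeasure]
    {R : Measure (LocFinMeasure G)} [SigmaFinite R] (hR : MeckeInvariant R)
    (hR0 : R {ξ | ξ.toMeasure = 0} = 0) : IsStationaryWithPalm lam (inversePalm lam R) R where
  sigmaFinite := sigmaFinite_inversePalm lam hR hR0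
  stationary := isStationary_inversePalm lam R
  null_zero := inversePalm_null_zero lam hR0
  palm _ hω := palmMeasure_inversePalm hω hR

theorem inversePalm_univ (lam : Measure G) [SFinite lam] (R : Measure (LocFinMeasure G)) :
    inversePalm lam R univ = ∫⁻ ξ, lam univ / ξ.toMeasure univ ∂ R := by
  rw [← lintegral_one, lintegral_inversePalm lam R measurable_const]
  simp [haarIntegral]

theorem inversePalm_perturb_univ (lam : Measure G) [SFinite lam] (R : Measure (LocFinMeasure G))
    (ν : Measure (Displacement G)) [SFinite ν] :
    inversePalm lam (perturb R ν) univ = inversePalm lam R univ * ν univ := by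
  have hm : Measurable fun ξ : LocFinMeasure G => lam univ / ξ.toMeasure univ :=
    measurable_const.div measurable_mass
  rw [inversePalm_univ, inversePalm_univ, lintegral_perturb R ν hm]
  simp only [displace_mass, lintegral_const]
  rw [lintegral_mul_const _ hm]

end Compact

end Palm

theorem mainTheorem6 {G : Type*} [AddCommGroup G] [TopologicalSpace G] [IsTopologicalAddGroup G]
    [T2Space G] [SecondCountableTopology G] [CompactSpace G] [MeasurableSpace G] [BorelSpace G]
    (lam : Measure G) [lam.IsAddHaarMeasure]
    (P : Measure (Palm.LocFinMeasure G)) (hPσ : SigmaFinite P) (hP : Palm.IsStationary P)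
    (hP0 : P {ξ | ξ.toMeasure = 0} = 0)
    (ν : Measure (Palm.Displacement G)) (hνσ : SigmaFinite ν) (hν : Palm.IsWeaklyStationary ν)
    (ω : G → ℝ≥0) (hω : Palm.IsWeight lam ω)
    (hσ : SigmaFinite (Palm.perturb (Palm.palmMeasure ω P) ν)) :
    (∃! Q, Palm.IsStationaryWithPalm lam Q (Palm.perturb (Palm.palmMeasure ω P) ν)) ∧
    ∀ Pν, Palm.IsStationaryWithPalm lam Pν (Palm.perturb (Palm.palmMeasure ω P) ν) →
      Pν univ = P univ * ν univ ∧
      (P ≠ 0 → ν ≠ 0 → (IsFiniteMeasure Pν ↔ IsFiniteMeasure P ∧ IsFiniteMeasure ν)) := by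
  have hpalm : Palm.palmMeasure ω P {ξ | ξ.toMeasure = 0} = 0 :=
    Palm.palmMeasure_null_zero hω.1 P
  have hR := (Palm.meckeInvariant_palmMeasure hω hP).perturb hν
  have hR0 := Palm.perturb_null_zero hpalm ν
  refine ⟨⟨_, Palm.isStationaryWithPalm_inversePalm lam hR hR0,
    fun Q hQ => hQ.eq_inversePalm⟩, fun Pν hPν => ?_⟩
  have hPinv : P = Palm.inversePalm lam (Palm.palmMeasure ω P) := by
    refine Measure.ext_of_lintegral _ fun g hg => ?_
    rw [Palm.lintegral_inversePalm lam _ hg, Palm.lintegral_eq_lintegral_palm hω hP hP0 hg]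
  have hmass : Pν univ = P univ * ν univ := by
    rw [hPν.eq_inversePalm, Palm.inversePalm_perturb_univ, ← hPinv]
  refine ⟨hmass, fun hPne hνne => ?_⟩
  have h1 : P univ ≠ 0 := fun h => hPne (Measure.measure_univ_eq_zero.1 h)
  have h2 : ν univ ≠ 0 := fun h => hνne (Measure.measure_univ_eq_zero.1 h)
  rw [isFiniteMeasure_iff, isFiniteMeasure_iff, isFiniteMeasure_iff, hmass,
    ENNReal.mul_lt_top_iff]
  tauto
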